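/- For positive integers $n$ and $d$ write $[n]=\{1,\dots,n\}$, and let $f_{\mathrm{lin}}(n,d,k,r)$ be the largest size of a subset of $[n]^d$ such that every $k$-dimensional linear subspace of $\mathbb{R}^d$ contains at most $r-1$ of its points. Let $d,k,r$ be positive integers with $k<d$ and $r\ge k+1$. Then, as $n\to\infty$, $f_{\mathrm{lin}}(n,d,k,r)=\Omega(g_{d,k,r}(n))$, where $$g_{d,k,r}(n)=\begin{cases} n^{d(r-k)/(r-1)}, & \text{if } r<d,\\ n^{d(d-k)/(d-1)}/(\log n)^{1/(d-1)}, & \text{otherwise.}\end{cases}$$ In particular, if $r=k+1$, then $f_{\mathrm{lin}}(n,d,k,k+1)=\Omega(h_{d,k}(n))$, where $$h_{d,k}(n)=\begin{cases} n^{d(d-k)/(d-1)}/(\log n)^{1/(d-1)}, & \text{if } k=d-1,\\ n^{d/k}, & \text{otherwise.}\end{cases}$$ The implied constants may depend on $d,k,r$ but not on $n$. -/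

import Mathlib

open Filter

/-- The lattice cube `[n]^d`, where `[n] = {1, …, n}`. -/
def latticeCube (n d : ℕ) : Finset (Fin d → ℕ) :=
  Fintype.piFinset fun _ => Finset.Icc 1 n

/-- A lattice point, regarded as a point of `ℝ^d`. -/
def toRealPoint {d : ℕ} (x : Fin d → ℕ) : Fin d → ℝ := fun i => (x i : ℝ)

open Classical in
/-- Every `k`-dimensional linear subspace of `ℝ^d` contains at most `r - 1` points of `S`
(that is, fewer than `r`). -/
def AvoidsLinear {d : ℕ} (k r : ℕ) (S : Finset (Fin d → ℕ)) : Prop :=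
  ∀ W : Submodule ℝ (Fin d → ℝ), Module.finrank ℝ W = k →
    (S.filter fun x => toRealPoint x ∈ W).card < r

open Classical in
/-- `f_lin(n, d, k, r)`: the largest size of a subset of `[n]^d` such that every `k`-dimensional
linear subspace contains at most `r - 1` of its points. -/
noncomputable def fLin (n d k r : ℕ) : ℕ :=
  ((latticeCube n d).powerset.filter fun S => AvoidsLinear k r S).sup Finset.card

/-- The lower bound for general `r`. -/
noncomputable def gLin (d k r n : ℕ) : ℝ :=
  if r < d then
    (n : ℝ) ^ ((d : ℝ) * ((r : ℝ) - k) / ((r : ℝ) - 1))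
  else
    (n : ℝ) ^ ((d : ℝ) * ((d : ℝ) - k) / ((d : ℝ) - 1)) /
      (Real.log n) ^ (1 / ((d : ℝ) - 1))

/-- The lower bound for `r = k + 1`; the first case is `k = d - 1`. -/
noncomputable def hLin (d k n : ℕ) : ℝ :=
  if k + 1 = d then
    (n : ℝ) ^ ((d : ℝ) * ((d : ℝ) - k) / ((d : ℝ) - 1)) /
      (Real.log n) ^ (1 / ((d : ℝ) - 1))
  else
    (n : ℝ) ^ ((d : ℝ) / (k : ℝ))

/-- `f(n) = Ω(g(n))` as `n → ∞`, for real sequences. -/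
def IsOmega (f g : ℕ → ℝ) : Prop :=
  ∃ c : ℝ, 0 < c ∧ ∀ᶠ n in atTop, c * g n ≤ f n

/-!
The lower bound comes from the deletion method (`exists_independent_subset`). Call an `r`-subset of
`[n]^d` bad if it lies in a `k`-dimensional linear subspace. A random subset of the cube of density
`p`, with one point removed from each bad set it contains, has expected size at least
`p n^d - B p^r`, where `B` is the number of bad sets. For `r ≤ d` one has `B = O(n^(dk))`, with an
additional factor `log n` if `r = d`, and the optimal `p` gives the claim. For `r > d` the bound for
`r = d` applies.

The points of a bad set are the rows of an `r × d` integer matrix of rank at most `k`, so the bound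
on `B` is an upper bound for the number of integer matrices of fixed rank in the spirit of
Katznelson (`card_rank_eq_le`). Count such matrices by their column space `V ⊆ ℚ^r`. If
`v 0, …, v j` are vectors realising the successive minima of the sup norm on `V ∩ ℤ^r`, then `V` has
at most `∏ i, 4 n / |v i|` integer points of norm at most `n` (`card_box_mul_prod_le`), so the number
of matrices with column space `V` is at most the `d`-th power of this. It remains to bound the sum of
`∏ i, |v i|^(-d)` over all `V`. Summing over all tuples of vectors would cost a power of `log n` when
`r = d`. However, `v j` may be replaced by `v j + t v 0` for `0 ≤ t < |v j| / |v 0|`, so each `V`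
arises from about `|v j| / |v 0|` tuples of comparable norms
(`IsMinimaSeq.prod_inv_le_sum_chainWeight`). With the weight `|u 0| / |u j|` this gains, the sum over
tuples `u` of increasing norms collapses from the last vector to the first, leaving
`∑ |x|^(-d)` over `x ∈ ℤ^r` with `0 < |x| ≤ 2 n` (`sum_chainWeight_le`), which is bounded for
`r < d` and logarithmic for `r = d`.
-/

/-! ### Integer points and the sup norm -/

/-- The sup norm of an integer vector, as a natural number. -/
def supNorm {r : ℕ} (x : Fin r → ℤ) : ℕ := Finset.univ.sup fun i => (x i).natAbs

/-- The inclusion `ℤ^r → ℚ^r`. -/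
def toRat {r : ℕ} : (Fin r → ℤ) →+ (Fin r → ℚ) := (Int.castAddHom ℚ).compLeft (Fin r)

theorem toRat_apply {r : ℕ} (x : Fin r → ℤ) (i : Fin r) : toRat x i = (x i : ℚ) := rfl

theorem toRat_injective {r : ℕ} : Function.Injective (toRat (r := r)) := by
  intro x y h
  funext i
  have := congrFun h i
  simpa [toRat_apply] using this

theorem toRat_zsmul {r : ℕ} (c : ℤ) (x : Fin r → ℤ) : toRat (c • x) = (c : ℚ) • toRat x := by
  funext i
  simp [toRat_apply]

theorem supNorm_le_iff {r : ℕ} {x : Fin r → ℤ} {n : ℕ} :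
    supNorm x ≤ n ↔ ∀ i, (x i).natAbs ≤ n := by
  simp [supNorm]

theorem natAbs_le_supNorm {r : ℕ} (x : Fin r → ℤ) (i : Fin r) : (x i).natAbs ≤ supNorm x :=
  supNorm_le_iff.1 le_rfl i

theorem supNorm_pos_iff {r : ℕ} {x : Fin r → ℤ} : 0 < supNorm x ↔ x ≠ 0 := by
  rw [Nat.pos_iff_ne_zero, not_iff_not, ← Nat.le_zero, supNorm_le_iff]
  simp [funext_iff]

theorem supNorm_add_le {r : ℕ} (x y : Fin r → ℤ) : supNorm (x + y) ≤ supNorm x + supNorm y := by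
  rw [supNorm_le_iff]
  intro i
  exact (Int.natAbs_add_le _ _).trans (add_le_add (natAbs_le_supNorm x i) (natAbs_le_supNorm y i))

theorem supNorm_neg {r : ℕ} (x : Fin r → ℤ) : supNorm (-x) = supNorm x := by
  simp [supNorm]

theorem supNorm_sub_le {r : ℕ} (x y : Fin r → ℤ) : supNorm (x - y) ≤ supNorm x + supNorm y := by
  rw [sub_eq_add_neg, ← supNorm_neg y]
  exact supNorm_add_le _ _

theorem supNorm_nsmul {r : ℕ} (c : ℕ) (x : Fin r → ℤ) : supNorm (c • x) = c * supNorm x := by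
  apply le_antisymm
  · rw [supNorm_le_iff]
    intro i
    simpa [Int.natAbs_mul] using Nat.mul_le_mul_left c (natAbs_le_supNorm x i)
  · rcases Nat.eq_zero_or_pos c with rfl | hc
    · simp
    · have : supNorm x ≤ supNorm (c • x) / c := by
        rw [supNorm_le_iff]
        intro i
        rw [Nat.le_div_iff_mul_le hc, mul_comm]
        simpa [Int.natAbs_mul] using natAbs_le_supNorm (c • x) i
      rw [Nat.le_div_iff_mul_le hc] at this
      linarith

/-! ### Counting integer points in a rational subspace -/

/-- An integer point outside a rational subspace is separated from it by an integer-valued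
homomorphism: clear the denominators of a linear functional. -/
theorem exists_int_functional {r : ℕ} (V : Submodule ℚ (Fin r → ℚ)) {z : Fin r → ℤ}
    (hz : toRat z ∉ V) :
    ∃ F : (Fin r → ℤ) →+ ℤ, F z ≠ 0 ∧ ∀ x, toRat x ∈ V → F x = 0 := by
  obtain ⟨f, hfz, hfV⟩ := Submodule.exists_le_ker_of_notMem hz
  let D : ℤ := ∏ i, ((f (Pi.single i 1)).den : ℤ)
  have hD : D ≠ 0 := Finset.prod_ne_zero_iff.2 fun i _ => by
    exact_mod_cast (f (Pi.single i 1)).den_nz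
  have hint : ∀ i, ∃ a : ℤ, (a : ℚ) = D * f (Pi.single i 1) := by
    intro i
    have hdvd : ((f (Pi.single i 1)).den : ℤ) ∣ D :=
      Finset.dvd_prod_of_mem (fun i => ((f (Pi.single i 1)).den : ℤ)) (Finset.mem_univ i)
    obtain ⟨e, he⟩ := hdvd
    refine ⟨e * (f (Pi.single i 1)).num, ?_⟩
    rw [he]
    push_cast
    have := Rat.mul_den_eq_num (f (Pi.single i 1))
    rw [← this]
    ring
  choose a ha using hint
  let F : (Fin r → ℤ) →+ ℤ :=
    { toFun := fun x => ∑ i, a i * x i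
      map_zero' := by simp
      map_add' := fun x y => by simp [mul_add, Finset.sum_add_distrib] }
  have hF : ∀ x, ((F x : ℤ) : ℚ) = D * f (toRat x) := by
    intro x
    have hx : toRat x = ∑ i, (x i : ℚ) • (Pi.single i 1 : Fin r → ℚ) := by
      funext j
      simp [toRat_apply, Finset.sum_apply, Pi.single_apply]
    rw [hx, map_sum, Finset.mul_sum]
    change (((∑ i, a i * x i : ℤ)) : ℚ) = _
    push_cast
    refine Finset.sum_congr rfl fun i _ => ?_
    rw [ha, map_smul, smul_eq_mul]
    ring
  refine ⟨F, ?_, ?_⟩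
  · intro h
    have := hF z
    rw [h] at this
    have h2 : (D : ℚ) ≠ 0 := by exact_mod_cast hD
    simp [h2, hfz] at this
  · intro x hx
    have := hF x
    rw [LinearMap.mem_ker.1 (hfV hx), mul_zero] at this
    exact_mod_cast this

/-- Every value of a homomorphism to `ℤ` on a subgroup is a multiple of one of these values. -/
theorem exists_forall_map_dvd {G : Type*} [AddCommGroup G] (L : AddSubgroup G) (F : G →+ ℤ) :
    ∃ w ∈ L, ∀ x ∈ L, F w ∣ F x := by
  obtain ⟨a, ha⟩ := Int.subgroup_cyclic (L.map F)
  rw [← AddSubgroup.zmultiples_eq_closure] at ha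
  have h1 : a ∈ L.map F := by rw [ha]; exact AddSubgroup.mem_zmultiples a
  obtain ⟨w, hw, rfl⟩ := h1
  refine ⟨w, hw, fun x hx => ?_⟩
  have h2 : F x ∈ AddSubgroup.zmultiples (F w) := by
    rw [← ha]; exact AddSubgroup.mem_map_of_mem F hx
  exact Int.mem_zmultiples_iff.1 h2

/-- The integer points of a rational subspace. -/
def latticePts {r : ℕ} (V : Submodule ℚ (Fin r → ℚ)) : AddSubgroup (Fin r → ℤ) :=
  V.toAddSubgroup.comap toRat

/-- The rational span of a family of integer vectors. -/
def ratSpan {r : ℕ} {ι : Type*} (v : ι → Fin r → ℤ) : Submodule ℚ (Fin r → ℚ) :=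
  Submodule.span ℚ (Set.range fun i => toRat (v i))

theorem toRat_mem_ratSpan {r : ℕ} {ι : Type*} (v : ι → Fin r → ℤ) (i : ι) :
    toRat (v i) ∈ ratSpan v :=
  Submodule.subset_span ⟨i, rfl⟩

theorem ratSpan_le {r : ℕ} {ι : Type*} {v : ι → Fin r → ℤ} {V : Submodule ℚ (Fin r → ℚ)} :
    ratSpan v ≤ V ↔ ∀ i, toRat (v i) ∈ V := by
  rw [ratSpan, Submodule.span_le]
  constructor
  · exact fun h i => h ⟨i, rfl⟩
  · rintro h _ ⟨i, rfl⟩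
    exact h i

/-- `v` is a sequence of vectors realising the successive minima of the sup norm on the integer
points of `V`: each `v j` lies outside the span of its predecessors, and is shortest among the
integer points of `V` that do. -/
structure IsMinimaSeq {r k : ℕ} (V : Submodule ℚ (Fin r → ℚ)) (v : Fin k → Fin r → ℤ) : Prop where
  mem : ∀ i, toRat (v i) ∈ V
  notMem : ∀ j, toRat (v j) ∉ ratSpan fun i : {i : Fin k // i < j} => v i
  le : ∀ j x, toRat x ∈ V → (toRat x ∉ ratSpan fun i : {i : Fin k // i < j} => v i) →
    supNorm (v j) ≤ supNorm x

theorem ratSpan_castSucc {r k : ℕ} (v : Fin (k + 1) → Fin r → ℤ) (j : Fin k) :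
    (ratSpan fun i : {i : Fin (k + 1) // i < j.castSucc} => v i) =
      ratSpan fun i : {i : Fin k // i < j} => v i.1.castSucc := by
  apply le_antisymm
  · rw [ratSpan_le]
    rintro ⟨i, hi⟩
    have hlt : (i : ℕ) < j := by simpa [Fin.lt_def] using hi
    exact toRat_mem_ratSpan (fun i : {i : Fin k // i < j} => v i.1.castSucc)
      ⟨⟨i, hlt.trans j.2⟩, Fin.lt_def.2 hlt⟩
  · rw [ratSpan_le]
    rintro ⟨i, hi⟩
    exact toRat_mem_ratSpan (fun i : {i : Fin (k + 1) // i < j.castSucc} => v i)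
      ⟨i.castSucc, Fin.castSucc_lt_castSucc_iff.2 hi⟩

theorem ratSpan_last {r k : ℕ} (v : Fin (k + 1) → Fin r → ℤ) :
    (ratSpan fun i : {i : Fin (k + 1) // i < Fin.last k} => v i) =
      ratSpan fun i : Fin k => v i.castSucc := by
  apply le_antisymm
  · rw [ratSpan_le]
    rintro ⟨i, hi⟩
    exact toRat_mem_ratSpan (fun i : Fin k => v i.castSucc) ⟨i, by simpa [Fin.lt_def] using hi⟩
  · rw [ratSpan_le]
    intro i
    exact toRat_mem_ratSpan (fun i : {i : Fin (k + 1) // i < Fin.last k} => v i)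
      ⟨i.castSucc, Fin.castSucc_lt_last i⟩

theorem IsMinimaSeq.ne_zero {r k : ℕ} {V : Submodule ℚ (Fin r → ℚ)} {v : Fin k → Fin r → ℤ}
    (h : IsMinimaSeq V v) (i : Fin k) : v i ≠ 0 := by
  intro h0
  apply h.notMem i
  rw [h0, map_zero]
  exact Submodule.zero_mem _

theorem IsMinimaSeq.monotone {r k : ℕ} {V : Submodule ℚ (Fin r → ℚ)} {v : Fin k → Fin r → ℤ}
    (h : IsMinimaSeq V v) : Monotone fun i => supNorm (v i) := by
  intro i j hij
  refine h.le i _ (h.mem j) fun hmem => h.notMem j ?_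
  refine (ratSpan_le.2 ?_ : _ ≤ _) hmem
  rintro ⟨l, hl⟩
  exact toRat_mem_ratSpan (fun i : {i : Fin k // i < j} => v i) ⟨l, hl.trans_le hij⟩

theorem IsMinimaSeq.castSucc {r k : ℕ} {V : Submodule ℚ (Fin r → ℚ)}
    {v : Fin (k + 1) → Fin r → ℤ} (h : IsMinimaSeq V v) :
    IsMinimaSeq V fun i : Fin k => v i.castSucc where
  mem i := h.mem _
  notMem j := by rw [← ratSpan_castSucc]; exact h.notMem _
  le j x hx hx' := by rw [← ratSpan_castSucc] at hx'; exact h.le _ x hx hx'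

theorem IsMinimaSeq.mono {r k : ℕ} {V W : Submodule ℚ (Fin r → ℚ)} {v : Fin k → Fin r → ℤ}
    (h : IsMinimaSeq V v) (hWV : W ≤ V) (hW : ∀ i, toRat (v i) ∈ W) : IsMinimaSeq W v where
  mem := hW
  notMem := h.notMem
  le j x hx hx' := h.le j x (hWV hx) hx'

theorem IsMinimaSeq.linearIndependent {r : ℕ} {V : Submodule ℚ (Fin r → ℚ)} :
    ∀ {k : ℕ} {v : Fin k → Fin r → ℤ}, IsMinimaSeq V v →
      LinearIndependent ℚ fun i => toRat (v i)
  | 0, _, _ => linearIndependent_empty_type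
  | k + 1, v, h => by
    rw [linearIndependent_finSucc']
    refine ⟨h.castSucc.linearIndependent, ?_⟩
    have := h.notMem (Fin.last k)
    rw [ratSpan_last] at this
    exact this

/-- The sublattice argument behind Minkowski's bound. If `q` is a divisor chain with
`q i * supNorm (v i) > 2 n`, the integer points of `V` have a subgroup `H` of index at most
`∏ i, q i` (expressed by the last clause) without nonzero points of norm at most `2 n`.
In a basis `w` adapted to the flag spanned by `v`, it is generated by the `q i • w i`. If the last
nonzero coordinate of a point of `H` is the `i`-th, the divisibilities make it `q i` times an
integer point outside the span of the vectors before `v i`, so its norm is at least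
`q i * supNorm (v i)`. -/
theorem exists_sparse_sublattice {r : ℕ} (n : ℕ) : ∀ (k : ℕ) (v : Fin k → Fin r → ℤ)
    (q : Fin k → ℕ), IsMinimaSeq (ratSpan v) v → (∀ i, 0 < q i) →
    (∀ i j, i ≤ j → q j ∣ q i) → (∀ i, 2 * n < q i * supNorm (v i)) →
    ∃ H : AddSubgroup (Fin r → ℤ), (∀ x ∈ H, x ≠ 0 → 2 * n < supNorm x) ∧
      (∀ p : ℕ, (∀ i, p ∣ q i) → ∀ x ∈ H, ∃ y, toRat y ∈ ratSpan v ∧ x = p • y) ∧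
      (∀ A : Finset (Fin r → ℤ), (∀ x ∈ A, toRat x ∈ ratSpan v) →
        (∀ x ∈ A, ∀ y ∈ A, x - y ∈ H → x = y) → A.card ≤ ∏ i, q i) := by
  intro k
  induction k with
  | zero =>
    intro v q _ _ _ _
    have hbot : ∀ x : Fin r → ℤ, toRat x ∈ ratSpan v → x = 0 := by
      intro x hx
      rw [ratSpan, Set.range_eq_empty, Submodule.span_empty, Submodule.mem_bot] at hx
      exact toRat_injective (by rw [hx, map_zero])
    refine ⟨⊥, ?_, ?_, ?_⟩
    · intro x hx hx0
      exact absurd (AddSubgroup.mem_bot.1 hx) hx0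
    · intro p _ x hx
      refine ⟨0, by rw [map_zero]; exact Submodule.zero_mem _, ?_⟩
      rw [AddSubgroup.mem_bot.1 hx, smul_zero]
    · intro A hA _
      rw [Finset.univ_eq_empty, Finset.prod_empty, Finset.card_le_one]
      intro a ha b hb
      rw [hbot a (hA a ha), hbot b (hA b hb)]
  | succ k ih =>
    intro v q hv hq hdvd hlarge
    set v' : Fin k → Fin r → ℤ := fun i => v i.castSucc with hv'
    have hle : ratSpan v' ≤ ratSpan v := ratSpan_le.2 fun i => toRat_mem_ratSpan v _
    have hlastNot : toRat (v (Fin.last k)) ∉ ratSpan v' := by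
      have := hv.notMem (Fin.last k)
      rwa [ratSpan_last] at this
    obtain ⟨H', hH'n, hH'p, hH'A⟩ := ih v' (fun i => q i.castSucc)
      (hv.castSucc.mono hle (toRat_mem_ratSpan v')) (fun i => hq _)
      (fun i j hij => hdvd _ _ (by simpa using hij)) (fun i => hlarge _)
    obtain ⟨F, hFlast, hFV'⟩ := exists_int_functional (ratSpan v') hlastNot
    have hspan : ratSpan v = Submodule.span ℚ {toRat (v (Fin.last k))} ⊔ ratSpan v' := by
      apply le_antisymm
      · rw [ratSpan_le]
        intro i
        refine Fin.lastCases ?_ (fun i => ?_) i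
        · exact Submodule.mem_sup_left (Submodule.mem_span_singleton_self _)
        · exact Submodule.mem_sup_right (toRat_mem_ratSpan v' i)
      · refine sup_le ?_ hle
        rw [Submodule.span_singleton_le_iff_mem]
        exact toRat_mem_ratSpan v _
    -- On the integer points of the whole span, `F` vanishes only on those of the smaller span.
    have hFker : ∀ x, toRat x ∈ ratSpan v → F x = 0 → toRat x ∈ ratSpan v' := by
      intro x hx hFx
      rw [hspan, Submodule.mem_sup] at hx
      obtain ⟨y, hy, z, hz, hyz⟩ := hx
      obtain ⟨c, rfl⟩ := Submodule.mem_span_singleton.1 hy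
      have hcz : toRat ((c.den : ℤ) • x - c.num • v (Fin.last k)) ∈ ratSpan v' := by
        have : toRat ((c.den : ℤ) • x - c.num • v (Fin.last k)) = (c.den : ℚ) • z := by
          rw [map_sub, toRat_zsmul, toRat_zsmul, ← hyz, smul_add, smul_smul]
          rw [show ((c.den : ℤ) : ℚ) = (c.den : ℚ) by norm_cast, Rat.den_mul_eq_num]
          abel
        rw [this]
        exact Submodule.smul_mem _ _ hz
      have h0 := hFV' _ hcz
      rw [map_sub, map_zsmul, map_zsmul, hFx, smul_zero, zero_sub, neg_eq_zero,
        smul_eq_mul] at h0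
      have hc : c = 0 := Rat.num_eq_zero.1 ((mul_eq_zero.1 h0).resolve_right hFlast)
      rw [← hyz, hc, zero_smul, zero_add]
      exact hz
    obtain ⟨w, hwmem, hwdvd⟩ := exists_forall_map_dvd (latticePts (ratSpan v)) F
    have hFw : F w ≠ 0 := by
      intro h
      have := hwdvd (v (Fin.last k)) (toRat_mem_ratSpan v _)
      rw [h, zero_dvd_iff] at this
      exact hFlast this
    set Q := q (Fin.last k) with hQ
    have hQpos : 0 < Q := hq _
    refine ⟨AddSubgroup.zmultiples (Q • w) ⊔ H', ?_, ?_, ?_⟩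
    · intro x hx hx0
      obtain ⟨y, hy, h, hh, rfl⟩ := AddSubgroup.mem_sup.1 hx
      obtain ⟨c, rfl⟩ := AddSubgroup.mem_zmultiples_iff.1 hy
      by_cases hc : c = 0
      · subst hc
        rw [zero_smul, zero_add] at hx0 ⊢
        exact hH'n h hh hx0
      · obtain ⟨y, hyV, rfl⟩ := hH'p Q (fun i => hdvd _ _ (Fin.le_last _)) h hh
        have hfac : c • Q • w + Q • y = Q • (c • w + y) := by
          rw [smul_add, smul_comm]
        rw [hfac, supNorm_nsmul]
        refine (hlarge (Fin.last k)).trans_le (Nat.mul_le_mul_left _ ?_)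
        refine hv.le _ _ ?_ ?_
        · exact (latticePts (ratSpan v)).add_mem
            ((latticePts (ratSpan v)).zsmul_mem hwmem c) (hle hyV)
        · rw [ratSpan_last]
          intro hmem
          have := hFV' _ hmem
          rw [map_add, map_zsmul, hFV' _ hyV, add_zero, smul_eq_mul] at this
          exact (mul_ne_zero hc hFw) this
    · intro p hp x hx
      obtain ⟨y, hy, h, hh, rfl⟩ := AddSubgroup.mem_sup.1 hx
      obtain ⟨c, rfl⟩ := AddSubgroup.mem_zmultiples_iff.1 hy
      obtain ⟨y, hyV, rfl⟩ := hH'p p (fun i => hp _) h hh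
      obtain ⟨e, he⟩ := hp (Fin.last k)
      refine ⟨c • e • w + y, ?_, ?_⟩
      · exact (latticePts (ratSpan v)).add_mem ((latticePts (ratSpan v)).zsmul_mem
          ((latticePts (ratSpan v)).nsmul_mem hwmem e) c) (hle hyV)
      · rw [hQ, he, smul_add, mul_smul, smul_comm c p]
    -- Sort the points of `A` by their `w`-coordinate `e` modulo `Q`. Subtracting `e x • w` moves
    -- each class injectively into the smaller span.
    · intro A hAV hAH
      let e : (Fin r → ℤ) → ℤ := fun x => F x / F w
      have he : ∀ x, toRat x ∈ ratSpan v → F x = e x * F w := fun x hx =>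
        (Int.ediv_mul_cancel (hwdvd x hx)).symm
      rw [Fin.prod_univ_castSucc]
      have hmaps : ∀ x ∈ A, (e x % Q).toNat ∈ Finset.range Q := by
        intro x _
        rw [Finset.mem_range]
        have h1 := Int.emod_lt_of_pos (e x) (by exact_mod_cast hQpos : (0 : ℤ) < Q)
        have h2 := Int.emod_nonneg (e x) (by exact_mod_cast hQpos.ne' : (Q : ℤ) ≠ 0)
        omega
      refine (Finset.card_le_mul_card_image_of_maps_to hmaps (∏ i : Fin k, q i.castSucc) ?_).trans
        (by rw [Finset.card_range])
      intro b _
      let π : (Fin r → ℤ) → (Fin r → ℤ) := fun x => x - e x • w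
      have hkey : ∀ x ∈ A.filter (fun x => (e x % Q).toNat = b),
          ∀ y ∈ A.filter (fun x => (e x % Q).toNat = b), π x - π y ∈ H' → x = y := by
        intro x hx y hy hxy
        rw [Finset.mem_filter] at hx hy
        refine hAH x hx.1 y hy.1 ?_
        have h1 := Int.emod_nonneg (e x) (by exact_mod_cast hQpos.ne' : (Q : ℤ) ≠ 0)
        have h2 := Int.emod_nonneg (e y) (by exact_mod_cast hQpos.ne' : (Q : ℤ) ≠ 0)
        have hmod : e y % Q = e x % Q := by omega
        obtain ⟨s, hs⟩ := Int.ModEq.dvd (show e y ≡ e x [ZMOD Q] from hmod)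
        have : x - y = s • Q • w + (π x - π y) := by
          have hs' : e x = e y + Q * s := by linarith
          simp only [π]
          rw [hs', add_smul, mul_smul, natCast_zsmul, smul_comm s Q]
          abel
        rw [this]
        exact AddSubgroup.add_mem_sup (AddSubgroup.zsmul_mem _
          (AddSubgroup.mem_zmultiples _) _) hxy
      have hinj : Set.InjOn π (A.filter fun x => (e x % Q).toNat = b) := by
        intro x hx y hy hxy
        exact hkey x hx y hy (by rw [hxy, sub_self]; exact H'.zero_mem)
      rw [← Finset.card_image_of_injOn hinj]
      refine hH'A _ ?_ ?_
      · intro z hz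
        obtain ⟨x, hx, rfl⟩ := Finset.mem_image.1 hz
        have hxV := hAV x (Finset.mem_filter.1 hx).1
        refine hFker _ ?_ ?_
        · exact (latticePts (ratSpan v)).sub_mem hxV ((latticePts (ratSpan v)).zsmul_mem hwmem _)
        · simp only [π]
          rw [map_sub, map_zsmul, smul_eq_mul, ← he x hxV, sub_self]
      · intro z hz z' hz' hzz
        obtain ⟨x, hx, rfl⟩ := Finset.mem_image.1 hz
        obtain ⟨y, hy, rfl⟩ := Finset.mem_image.1 hz'
        rw [hkey x hx y hy hzz]

/-- The integer vectors of sup norm at most `n`. -/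
noncomputable def intBox (r n : ℕ) : Finset (Fin r → ℤ) :=
  Fintype.piFinset fun _ => Finset.Icc (-(n : ℤ)) n

theorem mem_intBox {r n : ℕ} {x : Fin r → ℤ} : x ∈ intBox r n ↔ supNorm x ≤ n := by
  rw [intBox, Fintype.mem_piFinset, supNorm_le_iff]
  refine forall_congr' fun i => ?_
  rw [Finset.mem_Icc]
  omega

open Classical in
/-- A form of Minkowski's second theorem: the number of integer points of norm at most `n` in a
subspace is at most `∏ i, 4 n / λ i`, where the `λ i ≤ n` are its successive minima. -/
theorem card_box_mul_prod_le {r n k : ℕ} {V : Submodule ℚ (Fin r → ℚ)} {v : Fin k → Fin r → ℤ}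
    (hv : IsMinimaSeq V v) (hV : ratSpan v = V) (hn : ∀ i, supNorm (v i) ≤ n) :
    ((intBox r n).filter fun x => toRat x ∈ V).card * ∏ i, supNorm (v i) ≤ (4 * n) ^ k := by
  subst hV
  have hpos : ∀ i, 0 < supNorm (v i) := fun i => supNorm_pos_iff.2 (hv.ne_zero i)
  -- `q i` is the least power of two exceeding `2 n / supNorm (v i)`.
  let q : Fin k → ℕ := fun i => 2 ^ (Nat.log 2 (2 * n / supNorm (v i)) + 1)
  have hqpos : ∀ i, 0 < q i := fun i => by positivity
  have hlarge : ∀ i, 2 * n < q i * supNorm (v i) := by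
    intro i
    exact (Nat.div_lt_iff_lt_mul (hpos i)).1 (Nat.lt_pow_succ_log_self one_lt_two _)
  have hsmall : ∀ i, q i * supNorm (v i) ≤ 4 * n := by
    intro i
    have h1 : 2 * n / supNorm (v i) ≠ 0 :=
      (Nat.div_pos (by linarith [hn i]) (hpos i)).ne'
    have h2 := Nat.pow_log_le_self 2 h1
    have h3 := Nat.div_mul_le_self (2 * n) (supNorm (v i))
    have h4 := Nat.mul_le_mul_right (supNorm (v i)) h2
    simp only [q]
    rw [pow_succ]
    linarith
  have hdvd : ∀ i j, i ≤ j → q j ∣ q i := by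
    intro i j hij
    refine pow_dvd_pow 2 (Nat.succ_le_succ (Nat.log_mono_right ?_))
    exact Nat.div_le_div_left (hv.monotone hij) (hpos i)
  obtain ⟨H, hHn, -, hHA⟩ := exists_sparse_sublattice n k v q hv hqpos hdvd hlarge
  have hcard : ((intBox r n).filter fun x => toRat x ∈ ratSpan v).card ≤ ∏ i, q i := by
    refine hHA _ (fun x hx => (Finset.mem_filter.1 hx).2) ?_
    intro x hx y hy hxy
    by_contra hne
    have h1 := hHn _ hxy (sub_ne_zero.2 hne)
    have h2 := mem_intBox.1 (Finset.mem_filter.1 hx).1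
    have h3 := mem_intBox.1 (Finset.mem_filter.1 hy).1
    have := supNorm_sub_le x y
    omega
  calc _ ≤ (∏ i, q i) * ∏ i, supNorm (v i) := Nat.mul_le_mul_right _ hcard
    _ = ∏ i, q i * supNorm (v i) := Finset.prod_mul_distrib.symm
    _ ≤ ∏ _i : Fin k, 4 * n := Finset.prod_le_prod' fun i _ => hsmall i
    _ = (4 * n) ^ k := by simp

/-- Greedy construction of successive minima. -/
theorem exists_isMinimaSeq {r n : ℕ} (T : Set (Fin r → ℤ)) (hT : ∀ x ∈ T, supNorm x ≤ n) :
    ∀ k, k ≤ Module.finrank ℚ (Submodule.span ℚ (toRat '' T)) →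
      ∃ v : Fin k → Fin r → ℤ, IsMinimaSeq (Submodule.span ℚ (toRat '' T)) v ∧
        ∀ i, supNorm (v i) ≤ n := by
  set V := Submodule.span ℚ (toRat '' T)
  intro k
  induction k with
  | zero => exact fun _ => ⟨Fin.elim0, ⟨fun i => i.elim0, fun i => i.elim0, fun i => i.elim0⟩,
      fun i => i.elim0⟩
  | succ k ih =>
    intro hk
    obtain ⟨v, hv, hvn⟩ := ih (by omega)
    have hex : ∃ x ∈ T, toRat x ∉ ratSpan v := by
      by_contra! hcon
      have hle : V ≤ ratSpan v := by
        rw [Submodule.span_le]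
        rintro _ ⟨x, hx, rfl⟩
        exact hcon x hx
      have h1 := Submodule.finrank_mono hle
      have h2 : Module.finrank ℚ (ratSpan v) ≤ Fintype.card (Fin k) :=
        finrank_range_le_card (R := ℚ) fun i => toRat (v i)
      rw [Fintype.card_fin] at h2
      omega
    obtain ⟨x₀, hx₀T, hx₀⟩ := hex
    have hx₀V : toRat x₀ ∈ V := Submodule.subset_span ⟨x₀, hx₀T, rfl⟩
    obtain ⟨z, hz⟩ := exists_minimalFor_of_wellFoundedLT
      (fun x : Fin r → ℤ => toRat x ∈ V ∧ toRat x ∉ ratSpan v) supNorm ⟨x₀, hx₀V, hx₀⟩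
    have hzmin : ∀ x, toRat x ∈ V → toRat x ∉ ratSpan v → supNorm z ≤ supNorm x := by
      intro x hx hx'
      by_contra! hlt
      exact absurd (hz.2 ⟨hx, hx'⟩ hlt.le) (not_le.2 hlt)
    have hc : (fun i : Fin k => (Fin.snoc v z : Fin (k + 1) → Fin r → ℤ) i.castSucc) = v := by
      funext i
      simp
    refine ⟨Fin.snoc v z, ⟨?_, ?_, ?_⟩, ?_⟩
    · intro i
      refine Fin.lastCases ?_ (fun i => ?_) i
      · simpa using hz.1.1
      · simpa using hv.mem i
    · intro j
      refine Fin.lastCases ?_ (fun j => ?_) j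
      · rw [ratSpan_last, hc]
        simpa using hz.1.2
      · rw [ratSpan_castSucc]
        simpa using hv.notMem j
    · intro j x hx
      refine Fin.lastCases ?_ (fun j => ?_) j
      · rw [ratSpan_last, hc]
        simpa using hzmin x hx
      · rw [ratSpan_castSucc]
        simpa using hv.le j x hx
    · intro i
      refine Fin.lastCases ?_ (fun i => ?_) i
      · simpa using (hzmin x₀ hx₀V hx₀).trans (hT x₀ hx₀T)
      · simpa using hvn i

theorem IsMinimaSeq.ratSpan_eq {r k : ℕ} {V : Submodule ℚ (Fin r → ℚ)} {v : Fin k → Fin r → ℤ}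
    (h : IsMinimaSeq V v) (hk : Module.finrank ℚ V = k) : ratSpan v = V := by
  refine Submodule.eq_of_le_of_finrank_eq (ratSpan_le.2 h.mem) ?_
  rw [hk, ratSpan, finrank_span_eq_card h.linearIndependent, Fintype.card_fin]

/-! ### Sums over shells and chains -/

theorem card_intBox (r n : ℕ) : (intBox r n).card = (2 * n + 1) ^ r := by
  rw [intBox, Fintype.card_piFinset]
  simp only [Int.card_Icc, Finset.prod_const, Finset.card_univ, Fintype.card_fin]
  congr 1
  omega

theorem card_shell_le (r M m : ℕ) (hm : 1 ≤ m) :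
    (((intBox r M).filter fun x => supNorm x = m).card : ℝ) ≤
      2 * r * 3 ^ (r - 1) * (m : ℝ) ^ (r - 1) := by
  have hsub : ((intBox r M).filter fun x => supNorm x = m) ⊆ intBox r m \ intBox r (m - 1) := by
    intro x hx
    rw [Finset.mem_sdiff, mem_intBox, mem_intBox]
    have := (Finset.mem_filter.1 hx).2
    omega
  have hsub2 : intBox r (m - 1) ⊆ intBox r m := by
    intro x
    rw [mem_intBox, mem_intBox]
    omega
  have h1 := Finset.card_le_card hsub
  rw [Finset.card_sdiff_of_subset hsub2, card_intBox, card_intBox] at h1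
  obtain ⟨l, rfl⟩ : ∃ l, m = l + 1 := ⟨m - 1, by omega⟩
  have h2 := abs_pow_sub_pow_le ((2 * l + 3 : ℝ)) (2 * l + 1) r
  have hmax : max |(2 * l + 3 : ℝ)| |2 * l + 1| = 2 * l + 3 := by
    rw [abs_of_nonneg (by positivity), abs_of_nonneg (by positivity)]
    exact max_eq_left (by linarith)
  rw [hmax] at h2
  have h3 : (((2 * (l + 1) + 1) ^ r - (2 * (l + 1 - 1) + 1) ^ r : ℕ) : ℝ) =
      (2 * l + 3 : ℝ) ^ r - (2 * l + 1) ^ r := by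
    rw [Nat.cast_sub (Nat.pow_le_pow_left (by omega) r)]
    push_cast
    congr 2
    ring
  have h4 : (2 * l + 3 : ℝ) ^ (r - 1) ≤ 3 ^ (r - 1) * (l + 1 : ℝ) ^ (r - 1) := by
    rw [← mul_pow]
    gcongr
    linarith [(Nat.cast_nonneg l : (0 : ℝ) ≤ l)]
  calc _ ≤ (((2 * (l + 1) + 1) ^ r - (2 * (l + 1 - 1) + 1) ^ r : ℕ) : ℝ) := by exact_mod_cast h1
    _ ≤ |(2 * l + 3 : ℝ) - (2 * l + 1)| * r * (2 * l + 3) ^ (r - 1) := by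
      rw [h3]
      exact (le_abs_self _).trans h2
    _ = 2 * r * (2 * l + 3) ^ (r - 1) := by
      rw [show (2 * l + 3 : ℝ) - (2 * l + 1) = 2 by ring, abs_two]
    _ ≤ 2 * r * (3 ^ (r - 1) * (l + 1 : ℝ) ^ (r - 1)) := by gcongr
    _ = _ := by push_cast; ring

/-- A radial sum over `ℤ^r` is a sum over norms `m`, where the shell of norm `m` contributes a
factor `O(m ^ (r - 1))`. -/
theorem sum_intBox_le (r M a e : ℕ) (ha : 1 ≤ a) (he : r ≤ e) :
    ∑ x ∈ (intBox r M).filter (fun x => a ≤ supNorm x), ((supNorm x : ℝ) ^ e)⁻¹ ≤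
      2 * r * 3 ^ (r - 1) * ∑ m ∈ Finset.Icc a M, ((m : ℝ) ^ (e - r + 1))⁻¹ := by
  have hmaps : ∀ x ∈ (intBox r M).filter (fun x => a ≤ supNorm x),
      supNorm x ∈ Finset.Icc a M := by
    intro x hx
    rw [Finset.mem_filter, mem_intBox] at hx
    exact Finset.mem_Icc.2 ⟨hx.2, hx.1⟩
  rw [← Finset.sum_fiberwise_of_maps_to hmaps, Finset.mul_sum]
  refine Finset.sum_le_sum fun m hm => ?_
  have hm1 : 1 ≤ m := ha.trans (Finset.mem_Icc.1 hm).1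
  have hm0 : (0 : ℝ) < m := by exact_mod_cast hm1
  rcases Nat.eq_zero_or_pos r with rfl | hr
  · -- In dimension zero there is no point of positive norm.
    have hempty : (((intBox 0 M).filter fun x => a ≤ supNorm x).filter
        fun x => supNorm x = m) = ∅ := by
      refine Finset.filter_eq_empty_iff.2 fun x _ hx => ?_
      simp [supNorm] at hx
      omega
    rw [hempty]
    simp
  calc _ = ∑ x ∈ ((intBox r M).filter fun x => a ≤ supNorm x).filter fun x => supNorm x = m,
        ((m : ℝ) ^ e)⁻¹ := Finset.sum_congr rfl fun x hx => by rw [(Finset.mem_filter.1 hx).2]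
    _ ≤ ∑ x ∈ (intBox r M).filter fun x => supNorm x = m, ((m : ℝ) ^ e)⁻¹ := by
      refine Finset.sum_le_sum_of_subset_of_nonneg ?_ fun _ _ _ => by positivity
      exact Finset.filter_subset_filter _ (Finset.filter_subset _ _)
    _ = (((intBox r M).filter fun x => supNorm x = m).card : ℝ) * ((m : ℝ) ^ e)⁻¹ := by
      rw [Finset.sum_const, nsmul_eq_mul]
    _ ≤ 2 * r * 3 ^ (r - 1) * (m : ℝ) ^ (r - 1) * ((m : ℝ) ^ e)⁻¹ := by
      gcongr
      exact card_shell_le r M m hm1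
    _ = _ := by
      rw [mul_assoc]
      congr 1
      have : e = (r - 1) + (e - r + 1) := by omega
      nth_rewrite 1 [this]
      rw [pow_add, mul_inv, mul_inv_cancel_left₀ (by positivity)]

theorem sum_Icc_inv_sq_le (a M : ℕ) (ha : 1 ≤ a) :
    ∑ m ∈ Finset.Icc a M, ((m : ℝ) ^ 2)⁻¹ ≤ 2 / a := by
  have h := sum_Ioo_inv_sq_le (α := ℝ) (a - 1) (M + 1)
  have h2 : Finset.Ioo (a - 1) (M + 1) = Finset.Icc a M := by
    ext x
    simp only [Finset.mem_Ioo, Finset.mem_Icc]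
    omega
  rw [h2] at h
  have h3 : (((a - 1 : ℕ) : ℝ) + 1) = a := by
    rw [Nat.cast_sub ha]
    simp
  rwa [h3] at h

theorem sum_Icc_inv_pow_le (a M e : ℕ) (ha : 1 ≤ a) (he : 2 ≤ e) :
    ∑ m ∈ Finset.Icc a M, ((m : ℝ) ^ e)⁻¹ ≤ 2 / a := by
  refine (Finset.sum_le_sum fun m hm => ?_).trans (sum_Icc_inv_sq_le a M ha)
  have hm1 : (1 : ℝ) ≤ m := by exact_mod_cast ha.trans (Finset.mem_Icc.1 hm).1
  have : (m : ℝ) ^ 2 ≤ (m : ℝ) ^ e := pow_le_pow_right₀ hm1 he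
  gcongr

/-- The sum `∑ |x|^{-d-1}` over the integer points of norm at least `a` is `O(1 / a)`. -/
theorem sum_tail_le (r d M a : ℕ) (hrd : r ≤ d) (ha : 1 ≤ a) :
    ∑ x ∈ (intBox r M).filter (fun x => a ≤ supNorm x), ((supNorm x : ℝ) ^ (d + 1))⁻¹ ≤
      4 * r * 3 ^ (r - 1) / a := by
  refine (sum_intBox_le r M a (d + 1) ha (by omega)).trans ?_
  calc _ ≤ 2 * r * 3 ^ (r - 1) * (2 / a : ℝ) := by
        gcongr
        exact sum_Icc_inv_pow_le a M _ ha (by omega)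
    _ = _ := by ring

/-- The growth factor in the count of singular integer matrices: a logarithm for square ones. -/
noncomputable def logFactor (r d n : ℕ) : ℝ := if r < d then 1 else 1 + Real.log n

theorem sum_full_le (r d M : ℕ) (hrd : r ≤ d) :
    ∑ x ∈ (intBox r M).filter (fun x => 1 ≤ supNorm x), ((supNorm x : ℝ) ^ d)⁻¹ ≤
      4 * r * 3 ^ (r - 1) * logFactor r d M := by
  refine (sum_intBox_le r M 1 d le_rfl hrd).trans ?_
  rw [logFactor]
  split_ifs with h
  · calc _ ≤ 2 * r * 3 ^ (r - 1) * (2 / (1 : ℕ) : ℝ) := by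
          gcongr
          exact sum_Icc_inv_pow_le 1 M _ le_rfl (by omega)
      _ = _ := by push_cast; ring
  · have h1 : d - r + 1 = 1 := by omega
    have h2 := harmonic_le_one_add_log M
    rw [harmonic_eq_sum_Icc] at h2
    push_cast at h2
    rw [h1]
    simp only [pow_one]
    have h3 : (0 : ℝ) ≤ 1 + Real.log M := by
      have := Real.log_natCast_nonneg M
      linarith
    calc _ ≤ 2 * r * 3 ^ (r - 1) * (1 + Real.log M) := by gcongr
      _ ≤ 4 * r * 3 ^ (r - 1) * (1 + Real.log M) := by
        gcongr
        norm_num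

/-- The weight of a chain of vectors. Without the factor `N (u 0) / N (u last)`, each of the `j + 1`
vectors could contribute a logarithm to the sum of the weights of all chains; with it, only the
first one does. -/
noncomputable def chainWeight {α : Type*} {j : ℕ} (N : α → ℕ) (d : ℕ) (u : Fin (j + 1) → α) : ℝ :=
  (N (u 0) : ℝ) / N (u (Fin.last j)) * ∏ i, ((N (u i) : ℝ) ^ d)⁻¹

open Classical in
/-- Chains of length `j + 1` in `X`, along which `N` is monotone. -/
noncomputable def chains {α : Type*} (X : Finset α) (N : α → ℕ) (j : ℕ) :
    Finset (Fin (j + 1) → α) :=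
  (Fintype.piFinset fun _ => X).filter fun u => Monotone fun i => N (u i)

theorem mem_chains {α : Type*} {X : Finset α} {N : α → ℕ} {j : ℕ} {u : Fin (j + 1) → α} :
    u ∈ chains X N j ↔ (∀ i, u i ∈ X) ∧ Monotone fun i => N (u i) := by
  rw [chains, Finset.mem_filter, Fintype.mem_piFinset]

/-- Sum over the last member of the chain first: the factor `1 / N (u last)` gives the tail bound
`hK`, which returns the same factor for the last but one. -/
theorem sum_chainWeight_le {α : Type*} (X : Finset α) (N : α → ℕ) (d : ℕ) {K : ℝ}
    (hpos : ∀ x ∈ X, 1 ≤ N x)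
    (hK : ∀ a : ℕ, 1 ≤ a →
      ∑ x ∈ X.filter (fun x => a ≤ N x), ((N x : ℝ) ^ (d + 1))⁻¹ ≤ K / a) (j : ℕ) :
    ∑ u ∈ chains X N j, chainWeight N d u ≤ K ^ j * ∑ x ∈ X, ((N x : ℝ) ^ d)⁻¹ := by
  induction j with
  | zero =>
    rw [pow_zero, one_mul]
    refine le_of_eq (Finset.sum_nbij' (fun u => u 0) (fun x _ => x) ?_ ?_ ?_ ?_ ?_)
    · exact fun u hu => (mem_chains.1 hu).1 0
    · exact fun x hx => mem_chains.2 ⟨fun _ => hx, fun _ _ _ => le_rfl⟩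
    · intro u _
      funext i
      exact congrArg u (Subsingleton.elim (α := Fin 1) _ _)
    · exact fun _ _ => rfl
    · intro u hu
      have h0 : (N (u 0) : ℝ) ≠ 0 := by
        exact_mod_cast (Nat.one_le_iff_ne_zero.1 (hpos _ ((mem_chains.1 hu).1 0)))
      rw [chainWeight, Fin.prod_univ_one, Fin.last_zero, div_self h0, one_mul]
  | succ j ih =>
    have hsplit : ∑ u ∈ chains X N (j + 1), chainWeight N d u =
        ∑ u ∈ chains X N j, ∑ x ∈ X.filter (fun x => N (u (Fin.last j)) ≤ N x),
          chainWeight N d (Fin.snoc u x : Fin (j + 2) → α) := by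
      rw [Finset.sum_sigma']
      refine Finset.sum_bij' (fun u _ => ⟨Fin.init u, u (Fin.last _)⟩)
        (fun p _ => (Fin.snoc p.1 p.2 : Fin (j + 2) → α)) ?_ ?_ ?_ ?_ ?_
      · intro u hu
        obtain ⟨hX, hmono⟩ := mem_chains.1 hu
        rw [Finset.mem_sigma, mem_chains, Finset.mem_filter]
        exact ⟨⟨fun i => hX _, fun i i' h => hmono (Fin.castSucc_le_castSucc_iff.2 h)⟩,
          hX _, hmono (Fin.le_last _)⟩
      · rintro ⟨u, x⟩ hp
        rw [Finset.mem_sigma, mem_chains, Finset.mem_filter] at hp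
        obtain ⟨⟨hX, hmono⟩, hx, hle⟩ := hp
        rw [mem_chains]
        constructor
        · intro i
          refine Fin.lastCases ?_ (fun i => ?_) i
          · simpa using hx
          · simpa using hX i
        · intro i i' hii
          revert hii
          refine Fin.lastCases ?_ (fun i' => ?_) i'
          · refine Fin.lastCases ?_ (fun i => ?_) i
            · exact fun _ => le_rfl
            · intro _
              simpa using (hmono (Fin.le_last i)).trans hle
          · refine Fin.lastCases ?_ (fun i => ?_) i
            · intro h
              exact absurd h (not_le.2 (Fin.castSucc_lt_last _))
            · intro h
              simpa using hmono (Fin.castSucc_le_castSucc_iff.1 h)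
      · intro u _
        exact Fin.snoc_init_self u
      · rintro ⟨u, x⟩ _
        simp
      · intro u _
        simp only [Fin.snoc_init_self]
    rw [hsplit, pow_succ', mul_assoc]
    have hK0 : 0 ≤ K := by
      have h := hK 1 le_rfl
      rw [Nat.cast_one, div_one] at h
      exact (Finset.sum_nonneg fun _ _ => by positivity).trans h
    refine le_trans ?_ (mul_le_mul_of_nonneg_left ih hK0)
    rw [Finset.mul_sum]
    refine Finset.sum_le_sum fun u hu => ?_
    obtain ⟨hX, hmono⟩ := mem_chains.1 hu
    have hweight : ∀ x, chainWeight N d (Fin.snoc u x : Fin (j + 2) → α) =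
        (N (u 0) * ∏ i, ((N (u i) : ℝ) ^ d)⁻¹) * ((N x : ℝ) ^ (d + 1))⁻¹ := by
      intro x
      rw [chainWeight, Fin.prod_univ_castSucc]
      have h0 : (Fin.snoc u x : Fin (j + 2) → α) 0 = u 0 := by
        rw [← Fin.castSucc_zero, Fin.snoc_castSucc]
      simp only [h0, Fin.snoc_last, Fin.snoc_castSucc]
      rw [pow_succ, mul_inv, div_eq_mul_inv]
      ring
    simp only [hweight]
    rw [← Finset.mul_sum]
    calc _ ≤ (N (u 0) * ∏ i, ((N (u i) : ℝ) ^ d)⁻¹) * (K / N (u (Fin.last j))) := by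
          gcongr
          exact hK _ (hpos _ (hX _))
      _ = _ := by
        rw [chainWeight]
        ring

/-! ### Counting integer matrices of given rank -/

/-- The family `v` with a multiple of its first member added to its last one. -/
def shear {r j : ℕ} (v : Fin (j + 1) → Fin r → ℤ) (t : ℕ) : Fin (j + 1) → Fin r → ℤ :=
  Function.update v (Fin.last j) (v (Fin.last j) + t • v 0)

theorem shear_last {r j : ℕ} (v : Fin (j + 1) → Fin r → ℤ) (t : ℕ) :
    shear v t (Fin.last j) = v (Fin.last j) + t • v 0 := by
  simp [shear]

theorem shear_castSucc {r j : ℕ} (v : Fin (j + 1) → Fin r → ℤ) (t : ℕ) (i : Fin j) :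
    shear v t i.castSucc = v i.castSucc := by
  rw [shear, Function.update_of_ne (Fin.castSucc_lt_last i).ne]

theorem shear_zero {r j : ℕ} (v : Fin (j + 1) → Fin r → ℤ) : shear v 0 = v := by
  simp [shear]

theorem shear_apply_zero {r j : ℕ} (v : Fin (j + 1) → Fin r → ℤ) {t : ℕ} (h : t = 0 ∨ 0 < j) :
    shear v t 0 = v 0 := by
  rcases h with rfl | hj
  · rw [shear_zero]
  · rw [shear, Function.update_of_ne]
    exact (Fin.lt_def.2 (by simpa using hj) : (0 : Fin (j + 1)) < Fin.last j).ne

theorem ratSpan_shear {r j : ℕ} (v : Fin (j + 1) → Fin r → ℤ) {t : ℕ} (h : t = 0 ∨ 0 < j) :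
    ratSpan (shear v t) = ratSpan v := by
  apply le_antisymm
  · rw [ratSpan_le]
    intro i
    refine Fin.lastCases ?_ (fun i => ?_) i
    · rw [shear_last]
      exact (latticePts (ratSpan v)).add_mem (toRat_mem_ratSpan v _)
        ((latticePts (ratSpan v)).nsmul_mem (toRat_mem_ratSpan v 0) t)
    · rw [shear_castSucc]
      exact toRat_mem_ratSpan v _
  · rw [ratSpan_le]
    intro i
    refine Fin.lastCases ?_ (fun i => ?_) i
    · have h1 : v (Fin.last j) = shear v t (Fin.last j) - t • shear v t 0 := by
        rw [shear_last, shear_apply_zero v h, add_sub_cancel_right]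
      rw [h1]
      exact (latticePts (ratSpan (shear v t))).sub_mem (toRat_mem_ratSpan _ _)
        ((latticePts (ratSpan (shear v t))).nsmul_mem (toRat_mem_ratSpan _ 0) t)
    · rw [← shear_castSucc v t]
      exact toRat_mem_ratSpan _ _

section Minima

variable {r j : ℕ} {V : Submodule ℚ (Fin r → ℚ)} {v : Fin (j + 1) → Fin r → ℤ} {t : ℕ}

/-- The shears considered are genuine: for `j = 0`, where the first and last members coincide, only
the trivial one is within the range. -/
theorem IsMinimaSeq.shear_admissible (h : IsMinimaSeq V v)
    (ht : t < supNorm (v (Fin.last j)) / supNorm (v 0)) : t = 0 ∨ 0 < j := by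
  rcases Nat.eq_zero_or_pos j with rfl | hj
  · left
    rw [Fin.last_zero, Nat.div_self (supNorm_pos_iff.2 (h.ne_zero 0))] at ht
    omega
  · exact Or.inr hj

theorem supNorm_shear_last_le
    (ht : t < supNorm (v (Fin.last j)) / supNorm (v 0)) :
    supNorm (shear v t (Fin.last j)) ≤ 2 * supNorm (v (Fin.last j)) := by
  rw [shear_last]
  have h1 := supNorm_add_le (v (Fin.last j)) (t • v 0)
  rw [supNorm_nsmul] at h1
  have h2 := Nat.mul_le_mul_right (supNorm (v 0)) ht.le
  have h3 := Nat.div_mul_le_self (supNorm (v (Fin.last j))) (supNorm (v 0))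
  omega

theorem IsMinimaSeq.le_supNorm_shear_last (h : IsMinimaSeq V v) (ht : t = 0 ∨ 0 < j) :
    supNorm (v (Fin.last j)) ≤ supNorm (shear v t (Fin.last j)) := by
  rcases ht with rfl | hj
  · rw [shear_zero]
  · rw [shear_last]
    have h0 : toRat (v 0) ∈ ratSpan fun i : {i : Fin (j + 1) // i < Fin.last j} => v i :=
      toRat_mem_ratSpan (fun i : {i : Fin (j + 1) // i < Fin.last j} => v i)
        ⟨0, Fin.lt_def.2 (by simpa using hj)⟩
    refine h.le _ _ ((latticePts V).add_mem (h.mem _) ((latticePts V).nsmul_mem (h.mem 0) t)) ?_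
    intro hmem
    refine h.notMem (Fin.last j) ?_
    let W := ratSpan fun i : {i : Fin (j + 1) // i < Fin.last j} => v i
    have := (latticePts W).sub_mem hmem ((latticePts W).nsmul_mem h0 t)
    rwa [add_sub_cancel_right] at this

theorem IsMinimaSeq.shear_mem_chains (h : IsMinimaSeq V v) {n : ℕ} (hn : ∀ i, supNorm (v i) ≤ n)
    (ht : t < supNorm (v (Fin.last j)) / supNorm (v 0)) :
    shear v t ∈ chains ((intBox r (2 * n)).filter fun x => 1 ≤ supNorm x) supNorm j := by
  have hadm := h.shear_admissible ht
  have hpos : ∀ i, 1 ≤ supNorm (v i) := fun i => supNorm_pos_iff.2 (h.ne_zero i)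
  have hlast := h.le_supNorm_shear_last hadm
  rw [mem_chains]
  constructor
  · intro i
    rw [Finset.mem_filter, mem_intBox]
    refine Fin.lastCases ?_ (fun i => ?_) i
    · have h1 := supNorm_shear_last_le ht
      have h2 := hn (Fin.last j)
      have h3 := hpos (Fin.last j)
      omega
    · rw [shear_castSucc]
      have h2 := hn i.castSucc
      have h3 := hpos i.castSucc
      omega
  · intro i i' hii
    have hmono := h.monotone hii
    revert hii hmono
    refine Fin.lastCases ?_ (fun i' => ?_) i'
    · refine Fin.lastCases ?_ (fun i => ?_) i
      · exact fun _ _ => le_rfl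
      · intro _ hmono
        simp only [shear_castSucc]
        exact le_trans hmono hlast
    · refine Fin.lastCases ?_ (fun i => ?_) i
      · intro h
        exact absurd h (not_le.2 (Fin.castSucc_lt_last _))
      · intro _ hmono
        simpa only [shear_castSucc] using hmono

/-- Averaging over shears: a subspace with successive minima `v` contains about
`supNorm (v last) / supNorm (v 0)` admissible shears of `v`, all of comparable weight. -/
theorem IsMinimaSeq.prod_inv_le_sum_chainWeight (h : IsMinimaSeq V v) (d : ℕ) :
    ∏ i, ((supNorm (v i) : ℝ) ^ d)⁻¹ ≤
      2 ^ (d + 2) * ∑ t ∈ Finset.range (supNorm (v (Fin.last j)) / supNorm (v 0)),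
        chainWeight supNorm d (shear v t) := by
  set a := supNorm (v 0) with ha
  set b := supNorm (v (Fin.last j)) with hb
  have ha0 : 0 < a := supNorm_pos_iff.2 (h.ne_zero 0)
  have hab : a ≤ b := h.monotone (Fin.zero_le _)
  have hb0 : 0 < b := ha0.trans_le hab
  have ha0' : (0 : ℝ) < a := by exact_mod_cast ha0
  have hb0' : (0 : ℝ) < b := by exact_mod_cast hb0
  set P : ℝ := ∏ i, ((supNorm (v i) : ℝ) ^ d)⁻¹ with hP
  have hP0 : 0 ≤ P := Finset.prod_nonneg fun _ _ => by positivity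
  have hterm : ∀ t ∈ Finset.range (b / a),
      (a : ℝ) / (2 * b) * (P / 2 ^ d) ≤ chainWeight supNorm d (shear v t) := by
    intro t ht
    have ht' : t < supNorm (v (Fin.last j)) / supNorm (v 0) := Finset.mem_range.1 ht
    have hadm := h.shear_admissible ht'
    have h2 : (supNorm (shear v t (Fin.last j)) : ℝ) ≤ 2 * b := by
      exact_mod_cast supNorm_shear_last_le ht'
    have h3 : (0 : ℝ) < supNorm (shear v t (Fin.last j)) := by
      exact_mod_cast hb0.trans_le (h.le_supNorm_shear_last hadm)
    rw [chainWeight, shear_apply_zero v hadm]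
    have hprod : P / 2 ^ d ≤ ∏ i, ((supNorm (shear v t i) : ℝ) ^ d)⁻¹ := by
      rw [hP, Fin.prod_univ_castSucc, Fin.prod_univ_castSucc]
      simp only [shear_castSucc]
      rw [mul_div_assoc]
      refine mul_le_mul_of_nonneg_left ?_ (Finset.prod_nonneg fun _ _ => by positivity)
      rw [inv_eq_one_div, div_div, ← one_div, mul_comm, ← mul_pow]
      gcongr
    exact mul_le_mul (by gcongr) hprod (by positivity) (by positivity)
  have hsum := Finset.card_nsmul_le_sum _ _ _ hterm
  rw [Finset.card_range, nsmul_eq_mul] at hsum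
  have hdiv : (b : ℝ) / (2 * a) ≤ (b / a : ℕ) := by
    have h1 : 1 ≤ b / a := (Nat.one_le_div_iff ha0).2 hab
    have h2 : b < a * (b / a + 1) := Nat.lt_mul_div_succ b ha0
    have h3 : b ≤ 2 * a * (b / a) := by nlinarith
    rw [div_le_iff₀ (by positivity)]
    have h4 : (b : ℝ) ≤ 2 * a * (b / a : ℕ) := by exact_mod_cast h3
    linarith
  have hfin : (b : ℝ) / (2 * a) * ((a : ℝ) / (2 * b) * (P / 2 ^ d)) ≤
      ∑ t ∈ Finset.range (b / a), chainWeight supNorm d (shear v t) :=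
    (mul_le_mul_of_nonneg_right hdiv (by positivity)).trans hsum
  calc P = 2 ^ (d + 2) * ((b : ℝ) / (2 * a) * ((a : ℝ) / (2 * b) * (P / 2 ^ d))) := by
        rw [pow_add]
        field_simp
    _ ≤ _ := by gcongr

end Minima

open Classical in
/-- Upper bound for the number of `r × d` integer matrices of rank `j + 1` with entries at most
`n` in absolute value, given by their columns: sum over the column space `V`, bound the number of
choices for each column by the successive minima of `V`, and compare with the sum over chains. -/
theorem card_rank_eq_le (r d n j : ℕ) (hrd : r ≤ d) :
    (((Fintype.piFinset fun _ : Fin d => intBox r n).filter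
      fun c => Module.finrank ℚ (ratSpan c) = j + 1).card : ℝ) ≤
      ((4 * n : ℝ) ^ (j + 1)) ^ d * (2 ^ (d + 2) * ((4 * r * 3 ^ (r - 1)) ^ j *
        (4 * r * 3 ^ (r - 1) * logFactor r d (2 * n)))) := by
  set M := (Fintype.piFinset fun _ : Fin d => intBox r n).filter
    fun c => Module.finrank ℚ (ratSpan c) = j + 1 with hM
  have hexists : ∀ V ∈ M.image ratSpan, ∃ v : Fin (j + 1) → Fin r → ℤ, IsMinimaSeq V v ∧
      ratSpan v = V ∧ ∀ i, supNorm (v i) ≤ n := by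
    intro V hV
    obtain ⟨c, hc, rfl⟩ := Finset.mem_image.1 hV
    obtain ⟨hc1, hc2⟩ := Finset.mem_filter.1 hc
    have hrange : ratSpan c = Submodule.span ℚ (toRat '' Set.range c) := by
      rw [ratSpan, ← Set.range_comp]
      rfl
    have hT : ∀ x ∈ Set.range c, supNorm x ≤ n := by
      rintro _ ⟨i, rfl⟩
      exact mem_intBox.1 (Fintype.mem_piFinset.1 hc1 i)
    obtain ⟨v, hv, hvn⟩ := exists_isMinimaSeq (Set.range c) hT (j + 1) (by rw [← hrange, hc2])
    rw [← hrange] at hv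
    exact ⟨v, hv, hv.ratSpan_eq hc2, hvn⟩
  choose! v hv hvV hvn using hexists
  have hfiber : ∀ V ∈ M.image ratSpan, ((M.filter fun c => ratSpan c = V).card : ℝ) ≤
      ((4 * n : ℝ) ^ (j + 1)) ^ d * ∏ i, ((supNorm (v V i) : ℝ) ^ d)⁻¹ := by
    intro V hV
    have h1 : (M.filter fun c => ratSpan c = V).card ≤
        ((intBox r n).filter fun x => toRat x ∈ V).card ^ d := by
      have hsub : (M.filter fun c => ratSpan c = V) ⊆
          Fintype.piFinset fun _ : Fin d => (intBox r n).filter fun x => toRat x ∈ V := by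
        intro c hc
        obtain ⟨hcM, rfl⟩ := Finset.mem_filter.1 hc
        have hbox := Fintype.mem_piFinset.1 (Finset.mem_filter.1 hcM).1
        exact Fintype.mem_piFinset.2 fun i =>
          Finset.mem_filter.2 ⟨hbox i, toRat_mem_ratSpan c i⟩
      refine (Finset.card_le_card hsub).trans (le_of_eq ?_)
      rw [Fintype.card_piFinset_const]
    have h2 := card_box_mul_prod_le (hv V hV) (hvV V hV) (hvn V hV)
    have hpos : (0 : ℝ) < ∏ i, (supNorm (v V i) : ℝ) := Finset.prod_pos fun i _ => by
      exact_mod_cast supNorm_pos_iff.2 ((hv V hV).ne_zero i)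
    have h3 : (((intBox r n).filter fun x => toRat x ∈ V).card : ℝ) ≤
        (4 * n : ℝ) ^ (j + 1) * (∏ i, (supNorm (v V i) : ℝ))⁻¹ := by
      rw [← div_eq_mul_inv, le_div_iff₀ hpos]
      exact_mod_cast h2
    calc ((M.filter fun c => ratSpan c = V).card : ℝ)
        ≤ (((intBox r n).filter fun x => toRat x ∈ V).card : ℝ) ^ d := by exact_mod_cast h1
      _ ≤ ((4 * n : ℝ) ^ (j + 1) * (∏ i, (supNorm (v V i) : ℝ))⁻¹) ^ d := by gcongr
      _ = _ := by
        rw [mul_pow, inv_pow, ← Finset.prod_pow, Finset.prod_inv_distrib]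
  set X := (intBox r (2 * n)).filter fun x => 1 ≤ supNorm x with hX
  have hchains : ∑ V ∈ M.image ratSpan,
      ∑ t ∈ Finset.range (supNorm (v V (Fin.last j)) / supNorm (v V 0)),
        chainWeight supNorm d (shear (v V) t) ≤
        ∑ u ∈ chains X supNorm j, chainWeight supNorm d u := by
    rw [Finset.sum_sigma']
    have hinj : Set.InjOn (fun p : (_ : Submodule ℚ (Fin r → ℚ)) × ℕ => shear (v p.1) p.2)
        ((M.image ratSpan).sigma fun V =>
          Finset.range (supNorm (v V (Fin.last j)) / supNorm (v V 0))) := by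
      rintro ⟨V, t⟩ hp ⟨V', t'⟩ hp' heq
      rw [Finset.mem_coe, Finset.mem_sigma, Finset.mem_range] at hp hp'
      obtain ⟨hV, ht⟩ := hp
      obtain ⟨hV', ht'⟩ := hp'
      have had := (hv V hV).shear_admissible ht
      have had' := (hv V' hV').shear_admissible ht'
      have hVV : V = V' := by
        have := congrArg ratSpan heq
        simp only at this
        rwa [ratSpan_shear _ had, ratSpan_shear _ had', hvV V hV, hvV V' hV'] at this
      subst hVV
      have hlast := congrFun heq (Fin.last j)
      simp only [shear_last] at hlast
      have h0 : supNorm (t • v V 0) = supNorm (t' • v V 0) := by rw [add_left_cancel hlast]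
      rw [supNorm_nsmul, supNorm_nsmul] at h0
      rw [Nat.eq_of_mul_eq_mul_right (supNorm_pos_iff.2 ((hv V hV).ne_zero 0)) h0]
    rw [← Finset.sum_image (f := fun u => chainWeight supNorm d u) hinj]
    refine Finset.sum_le_sum_of_subset_of_nonneg ?_ ?_
    · intro u hu
      obtain ⟨⟨V, t⟩, hp, rfl⟩ := Finset.mem_image.1 hu
      rw [Finset.mem_sigma, Finset.mem_range] at hp
      exact (hv V hp.1).shear_mem_chains (hvn V hp.1) hp.2
    · intro u _ _
      rw [chainWeight]
      exact mul_nonneg (by positivity) (Finset.prod_nonneg fun _ _ => by positivity)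
  have hbound : ∑ u ∈ chains X supNorm j, chainWeight supNorm d u ≤
      (4 * r * 3 ^ (r - 1)) ^ j * (4 * r * 3 ^ (r - 1) * logFactor r d (2 * n)) := by
    refine (sum_chainWeight_le X supNorm d (K := 4 * r * 3 ^ (r - 1)) ?_ ?_ j).trans ?_
    · exact fun x hx => (Finset.mem_filter.1 hx).2
    · intro a ha
      have : X.filter (fun x => a ≤ supNorm x) =
          (intBox r (2 * n)).filter fun x => a ≤ supNorm x := by
        rw [hX, Finset.filter_filter]
        refine Finset.filter_congr fun x _ => ⟨fun h => h.2, fun h => ⟨ha.trans h, h⟩⟩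
      rw [this]
      exact sum_tail_le r d (2 * n) a hrd ha
    · refine mul_le_mul_of_nonneg_left ?_ (by positivity)
      exact sum_full_le r d (2 * n) hrd
  calc (M.card : ℝ) = ∑ V ∈ M.image ratSpan, ((M.filter fun c => ratSpan c = V).card : ℝ) := by
        rw [Finset.card_eq_sum_card_image ratSpan M]
        push_cast
        rfl
    _ ≤ ∑ V ∈ M.image ratSpan, ((4 * n : ℝ) ^ (j + 1)) ^ d * (2 ^ (d + 2) *
        ∑ t ∈ Finset.range (supNorm (v V (Fin.last j)) / supNorm (v V 0)),
          chainWeight supNorm d (shear (v V) t)) := by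
      refine Finset.sum_le_sum fun V hV => (hfiber V hV).trans ?_
      gcongr
      exact (hv V hV).prod_inv_le_sum_chainWeight d
    _ = ((4 * n : ℝ) ^ (j + 1)) ^ d * (2 ^ (d + 2) * ∑ V ∈ M.image ratSpan,
        ∑ t ∈ Finset.range (supNorm (v V (Fin.last j)) / supNorm (v V 0)),
          chainWeight supNorm d (shear (v V) t)) := by
      rw [← Finset.mul_sum, ← Finset.mul_sum]
    _ ≤ _ := by
      gcongr
      exact hchains.trans hbound

/-- There are `O(n ^ (k d))` nonzero integer `r × d` matrices with entries at most `n` and rank at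
most `k` if `r < d`, and `O(n ^ (k d) log n)` if `r = d`. -/
theorem exists_card_rank_le (r d k : ℕ) (hrd : r ≤ d) :
    ∃ C : ℝ, 1 ≤ C ∧ ∀ n : ℕ, 3 ≤ n → ∀ M : Finset (Fin d → Fin r → ℤ),
      (∀ c ∈ M, (∀ i, supNorm (c i) ≤ n) ∧ 1 ≤ Module.finrank ℚ (ratSpan c) ∧
        Module.finrank ℚ (ratSpan c) ≤ k) →
      (M.card : ℝ) ≤ C * ((n : ℝ) ^ (k * d) * if r < d then 1 else Real.log n) := by
  classical
  let A : ℕ → ℝ := fun j => 4 ^ ((j + 1) * d) * (2 ^ (d + 2) * ((4 * r * 3 ^ (r - 1)) ^ j *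
    (4 * r * 3 ^ (r - 1) * 3)))
  have hA : ∀ j, 0 ≤ A j := fun j => by positivity
  refine ⟨1 + ∑ j ∈ Finset.range k, A j, ?_, ?_⟩
  · have := Finset.sum_nonneg fun j (_ : j ∈ Finset.range k) => hA j
    linarith
  intro n hn M hM
  have hn' : (3 : ℝ) ≤ n := by exact_mod_cast hn
  have hlog1 : 1 ≤ Real.log n := by
    rw [Real.le_log_iff_exp_le (by linarith)]
    linarith [Real.exp_one_lt_d9]
  set L : ℝ := if r < d then 1 else Real.log n with hL
  have hL1 : 1 ≤ L := by rw [hL]; split_ifs <;> linarith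
  have hlogFactor : logFactor r d (2 * n) ≤ 3 * L := by
    rw [logFactor, hL]
    split_ifs
    · norm_num
    · push_cast
      rw [Real.log_mul (by norm_num) (by linarith)]
      linarith [Real.log_two_lt_d9]
  have hsub : M ⊆ (Finset.range k).biUnion fun j =>
      (Fintype.piFinset fun _ : Fin d => intBox r n).filter
        fun c => Module.finrank ℚ (ratSpan c) = j + 1 := by
    intro c hc
    obtain ⟨h1, h2, h3⟩ := hM c hc
    rw [Finset.mem_biUnion]
    refine ⟨Module.finrank ℚ (ratSpan c) - 1, Finset.mem_range.2 (by omega), ?_⟩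
    rw [Finset.mem_filter, Fintype.mem_piFinset]
    exact ⟨fun i => mem_intBox.2 (h1 i), by omega⟩
  calc (M.card : ℝ) ≤ ∑ j ∈ Finset.range k,
        (((Fintype.piFinset fun _ : Fin d => intBox r n).filter
          fun c => Module.finrank ℚ (ratSpan c) = j + 1).card : ℝ) := by
        exact_mod_cast (Finset.card_le_card hsub).trans Finset.card_biUnion_le
    _ ≤ ∑ j ∈ Finset.range k, A j * ((n : ℝ) ^ (k * d) * L) := by
      refine Finset.sum_le_sum fun j hj => (card_rank_eq_le r d n j hrd).trans ?_
      have hjk : j + 1 ≤ k := Finset.mem_range.1 hj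
      have hpow : (n : ℝ) ^ ((j + 1) * d) ≤ (n : ℝ) ^ (k * d) :=
        pow_le_pow_right₀ (by linarith) (Nat.mul_le_mul_right d hjk)
      calc _ ≤ ((4 * n : ℝ) ^ (j + 1)) ^ d * (2 ^ (d + 2) * ((4 * r * 3 ^ (r - 1)) ^ j *
            (4 * r * 3 ^ (r - 1) * (3 * L)))) := by gcongr
        _ = A j * ((n : ℝ) ^ ((j + 1) * d) * L) := by
          rw [← pow_mul, mul_pow]
          ring
        _ ≤ _ := mul_le_mul_of_nonneg_left
          (mul_le_mul_of_nonneg_right hpow (by linarith)) (hA j)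
    _ = (∑ j ∈ Finset.range k, A j) * ((n : ℝ) ^ (k * d) * L) := by rw [Finset.sum_mul]
    _ ≤ _ := by
      refine mul_le_mul_of_nonneg_right (by linarith) ?_
      exact mul_nonneg (by positivity) (by linarith)

/-! ### Degenerate sets of lattice points -/

/-- The rank of an integer matrix over `ℚ`, computed by columns, is at most its rank over `ℝ`,
computed by rows. -/
theorem finrank_ratSpan_le {r d : ℕ} (e : Fin r → Fin d → ℕ) :
    Module.finrank ℚ (ratSpan fun (i : Fin d) (l : Fin r) => (e l i : ℤ)) ≤
      Module.finrank ℝ (Submodule.span ℝ (Set.range fun l => toRealPoint (e l))) := by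
  let A : Matrix (Fin r) (Fin d) ℚ := fun l i => (e l i : ℚ)
  have h1 : (ratSpan fun (i : Fin d) (l : Fin r) => (e l i : ℤ)) =
      Submodule.span ℚ (Set.range A.col) := by
    rw [ratSpan]
    congr 2
  rw [h1, ← Matrix.rank_eq_finrank_span_cols, Matrix.rank_eq_finrank_span_row]
  -- Rows that form a basis of the rational row space stay linearly independent over `ℝ`.
  obtain ⟨κ, a, ha, hspan, hli⟩ := exists_linearIndependent' ℚ A.row
  have : Fintype κ := @Fintype.ofFinite κ (Finite.of_injective a ha)
  rw [← hspan, finrank_span_eq_card hli]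
  have hreal : LinearIndependent ℝ fun i => toRealPoint (e (a i)) := by
    have := (linearIndependent_algebraMap_comp_iff (S := ℝ)).2 hli
    have heq : (fun i => toRealPoint (e (a i))) =
        fun i => algebraMap ℚ ℝ ∘ (A.row ∘ a) i := by
      funext i x
      simp [toRealPoint, A, Matrix.row]
    rw [heq]
    exact this
  rw [← finrank_span_eq_card hreal]
  refine Submodule.finrank_mono (Submodule.span_mono ?_)
  rintro _ ⟨i, rfl⟩
  exact ⟨a i, rfl⟩

open Classical in
/-- The number of `r`-subsets of the cube that lie in a `k`-dimensional linear subspace: the points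
of such a set are the rows of an integer matrix of rank at most `k`. -/
theorem exists_card_degenerate_le (d k r : ℕ) (hr : 1 ≤ r) (hrd : r ≤ d) :
    ∃ C : ℝ, 1 ≤ C ∧ ∀ n : ℕ, 3 ≤ n →
      ((((latticeCube n d).powersetCard r).filter fun R : Finset (Fin d → ℕ) => Module.finrank ℝ
        (Submodule.span ℝ (toRealPoint '' (R : Set (Fin d → ℕ)))) ≤ k).card : ℝ) ≤
      C * ((n : ℝ) ^ (k * d) * if r < d then 1 else Real.log n) := by
  obtain ⟨C, hC1, hC⟩ := exists_card_rank_le r d k hrd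
  refine ⟨C, hC1, fun n hn => ?_⟩
  set 𝓑 := ((latticeCube n d).powersetCard r).filter fun R : Finset (Fin d → ℕ) => Module.finrank ℝ
    (Submodule.span ℝ (toRealPoint '' (R : Set (Fin d → ℕ)))) ≤ k with h𝓑
  have henum : ∀ R ∈ 𝓑, ∃ e : Fin r → Fin d → ℕ, Set.range e = (R : Set (Fin d → ℕ)) := by
    intro R hR
    have hcard := (Finset.mem_powersetCard.1 (Finset.mem_filter.1 hR).1).2
    refine ⟨fun l => ((R.equivFinOfCardEq hcard).symm l : Fin d → ℕ), ?_⟩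
    ext x
    constructor
    · rintro ⟨l, rfl⟩
      exact ((R.equivFinOfCardEq hcard).symm l).2
    · intro hx
      exact ⟨R.equivFinOfCardEq hcard ⟨x, hx⟩, by simp⟩
  choose! e he using henum
  have hinj : Set.InjOn (fun R (i : Fin d) (l : Fin r) => (e R l i : ℤ)) 𝓑 := by
    intro R hR R' hR' h
    have hee : e R = e R' := by
      funext l i
      have := congrFun (congrFun h i) l
      simp only at this
      exact_mod_cast this
    have := he R hR
    rw [hee, he R' hR'] at this
    exact (Finset.coe_injective this).symm
  rw [← Finset.card_image_of_injOn hinj]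
  refine hC n hn _ ?_
  intro c hc
  obtain ⟨R, hR, rfl⟩ := Finset.mem_image.1 hc
  obtain ⟨hR1, hR2⟩ := Finset.mem_filter.1 hR
  have hmem : ∀ l i, 1 ≤ e R l i ∧ e R l i ≤ n := by
    intro l i
    have h1 : e R l ∈ R := by
      rw [← Finset.mem_coe, ← he R hR]
      exact ⟨l, rfl⟩
    have h2 := (Finset.mem_powersetCard.1 hR1).1 h1
    rw [latticeCube, Fintype.mem_piFinset] at h2
    exact Finset.mem_Icc.1 (h2 i)
  refine ⟨fun i => ?_, ?_, ?_⟩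
  · rw [supNorm_le_iff]
    intro l
    simpa using (hmem l i).2
  · rw [Submodule.one_le_finrank_iff]
    intro hbot
    have h0 := toRat_mem_ratSpan (fun (i : Fin d) (l : Fin r) => (e R l i : ℤ)) ⟨0, by omega⟩
    rw [hbot, Submodule.mem_bot] at h0
    have h1 := congrFun h0 ⟨0, hr⟩
    have h2 := (hmem ⟨0, hr⟩ ⟨0, by omega⟩).1
    simp [toRat_apply] at h1
    omega
  · refine (finrank_ratSpan_le (e R)).trans ?_
    have : (Set.range fun l => toRealPoint (e R l)) = toRealPoint '' (R : Set (Fin d → ℕ)) := by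
      rw [← he R hR, ← Set.range_comp]
      rfl
    rwa [this]

/-! ### The deletion method -/

open Classical in
/-- The probability that a `p`-random subset of `X` contains `R` is `p ^ |R|`. -/
theorem sum_powerset_contains {α : Type*} (X R : Finset α) (hR : R ⊆ X) (p : ℝ) :
    ∑ S ∈ X.powerset, p ^ S.card * (1 - p) ^ (X \ S).card * (if R ⊆ S then 1 else 0) =
      p ^ R.card := by
  have h := Finset.prod_add (fun _ : α => p) (fun x : α => if x ∈ R then (0 : ℝ) else 1 - p) X
  have hl : ∏ x ∈ X, (p + if x ∈ R then 0 else 1 - p) = p ^ R.card := by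
    rw [Finset.prod_congr rfl (g := fun x => if x ∈ R then p else 1)
      (fun x _ => by split_ifs <;> ring), Finset.prod_ite_mem, Finset.inter_eq_right.2 hR,
      Finset.prod_const]
  rw [← hl, h]
  refine Finset.sum_congr rfl fun S hS => ?_
  rw [Finset.prod_const, mul_assoc]
  congr 1
  by_cases hRS : R ⊆ S
  · rw [if_pos hRS, mul_one, Finset.prod_congr rfl (g := fun _ => 1 - p), Finset.prod_const]
    intro x hx
    rw [if_neg fun hxR => (Finset.mem_sdiff.1 hx).2 (hRS hxR)]
  · rw [if_neg hRS, mul_zero]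
    obtain ⟨x, hxR, hxS⟩ := Finset.not_subset.1 hRS
    symm
    apply Finset.prod_eq_zero (Finset.mem_sdiff.2 ⟨hR hxR, hxS⟩)
    exact if_pos hxR

/-- The deletion method: remove one point of each bad set contained in a `p`-random subset. -/
theorem exists_independent_subset {α : Type*} (X : Finset α) (𝓑 : Finset (Finset α)) (r : ℕ)
    (hr : 1 ≤ r) (h𝓑 : ∀ R ∈ 𝓑, R ⊆ X ∧ R.card = r) {p : ℝ} (hp0 : 0 ≤ p) (hp1 : p ≤ 1) :
    ∃ S ⊆ X, (∀ R ∈ 𝓑, ¬ R ⊆ S) ∧ p * X.card - 𝓑.card * p ^ r ≤ S.card := by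
  classical
  let w : Finset α → ℝ := fun S => p ^ S.card * (1 - p) ^ (X \ S).card
  have hw0 : ∀ S, 0 ≤ w S := fun S =>
    mul_nonneg (pow_nonneg hp0 _) (pow_nonneg (by linarith) _)
  have hw1 : ∑ S ∈ X.powerset, w S = 1 := by
    have := sum_powerset_contains X ∅ (Finset.empty_subset _) p
    simpa using this
  let bad : Finset α → Finset (Finset α) := fun S => 𝓑.filter fun R => R ⊆ S
  have hcard : ∑ S ∈ X.powerset, w S * S.card = p * X.card := by
    have h1 : ∀ S ∈ X.powerset, w S * S.card =
        ∑ x ∈ X, w S * (if {x} ⊆ S then 1 else 0) := by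
      intro S hS
      rw [← Finset.mul_sum]
      simp only [Finset.singleton_subset_iff]
      rw [Finset.sum_ite_mem, Finset.inter_eq_right.2 (Finset.mem_powerset.1 hS)]
      simp
    rw [Finset.sum_congr rfl h1, Finset.sum_comm, Finset.sum_congr rfl (fun x hx =>
      sum_powerset_contains X {x} (Finset.singleton_subset_iff.2 hx) p)]
    simp [mul_comm]
  have hbad : ∑ S ∈ X.powerset, w S * (bad S).card = 𝓑.card * p ^ r := by
    have h1 : ∀ S ∈ X.powerset, w S * (bad S).card =
        ∑ R ∈ 𝓑, w S * (if R ⊆ S then 1 else 0) := by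
      intro S _
      rw [← Finset.mul_sum, Finset.sum_boole]
    rw [Finset.sum_congr rfl h1, Finset.sum_comm, Finset.sum_congr rfl (fun R hR =>
      sum_powerset_contains X R (h𝓑 R hR).1 p), Finset.sum_congr rfl (fun R hR => by
      rw [(h𝓑 R hR).2])]
    simp
  obtain ⟨S, hSX, hS⟩ : ∃ S ∈ X.powerset,
      p * X.card - 𝓑.card * p ^ r ≤ (S.card : ℝ) - (bad S).card := by
    by_contra! hcon
    have h1 : ∑ S ∈ X.powerset, w S * ((S.card : ℝ) - (bad S).card) <
        ∑ S ∈ X.powerset, w S * (p * X.card - 𝓑.card * p ^ r) := by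
      refine Finset.sum_lt_sum (fun S hS => mul_le_mul_of_nonneg_left (hcon S hS).le (hw0 S)) ?_
      by_contra! hle
      have h0 : ∀ S ∈ X.powerset, w S = 0 := by
        intro S hS
        by_contra hne
        exact absurd (mul_lt_mul_of_pos_left (hcon S hS) ((hw0 S).lt_of_ne' hne))
          (not_lt.2 (hle S hS))
      rw [Finset.sum_eq_zero h0] at hw1
      exact zero_ne_one hw1
    rw [← Finset.sum_mul, hw1, one_mul] at h1
    simp only [mul_sub, Finset.sum_sub_distrib] at h1
    rw [hcard, hbad] at h1
    exact lt_irrefl _ h1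
  have hne : ∀ R ∈ bad S, R.Nonempty := by
    intro R hR
    have := (h𝓑 R (Finset.mem_filter.1 hR).1).2
    exact Finset.card_pos.1 (by omega)
  rcases X.eq_empty_or_nonempty with rfl | ⟨x₀, -⟩
  · refine ⟨∅, le_rfl, fun R hR hRS => ?_, ?_⟩
    · have := (h𝓑 R hR).2
      rw [Finset.subset_empty.1 hRS, Finset.card_empty] at this
      omega
    · have : 0 ≤ (𝓑.card : ℝ) * p ^ r := by positivity
      simpa using this
  have : Nonempty α := ⟨x₀⟩
  choose! x hx using hne
  refine ⟨S \ (bad S).image x, Finset.sdiff_subset.trans (Finset.mem_powerset.1 hSX), ?_, ?_⟩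
  · intro R hR hRS
    have hRbad : R ∈ bad S := Finset.mem_filter.2 ⟨hR, hRS.trans Finset.sdiff_subset⟩
    exact (Finset.mem_sdiff.1 (hRS (hx R hRbad))).2 (Finset.mem_image_of_mem x hRbad)
  · have h1 := Finset.le_card_sdiff ((bad S).image x) S
    have h2 : ((bad S).image x).card ≤ (bad S).card := Finset.card_image_le
    have h3 : S.card ≤ (S \ (bad S).image x).card + (bad S).card := by omega
    have h4 : (S.card : ℝ) ≤ (S \ (bad S).image x).card + (bad S).card := by exact_mod_cast h3
    linarith

/-! ### The lower bound -/

theorem card_le_fLin {n d k r : ℕ} {S : Finset (Fin d → ℕ)} (hS : S ⊆ latticeCube n d)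
    (h : AvoidsLinear k r S) : S.card ≤ fLin n d k r := by
  classical
  exact Finset.le_sup (f := Finset.card) (Finset.mem_filter.2 ⟨Finset.mem_powerset.2 hS, h⟩)

theorem fLin_mono {n d k r r' : ℕ} (h : r ≤ r') : fLin n d k r ≤ fLin n d k r' := by
  classical
  refine Finset.sup_le fun S hS => ?_
  obtain ⟨hS1, hS2⟩ := Finset.mem_filter.1 hS
  exact card_le_fLin (Finset.mem_powerset.1 hS1) fun W hW => (hS2 W hW).trans_le h

/-- The lower bound for `r ≤ d`; larger `r` reduce to `r = d` by monotonicity. -/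
theorem exists_le_fLin (d k r : ℕ) (hk : 1 ≤ k) (hkr : k + 1 ≤ r) (hrd : r ≤ d) :
    ∃ c : ℝ, 0 < c ∧ ∀ n : ℕ, 3 ≤ n →
      c * ((n : ℝ) ^ ((d : ℝ) * ((r : ℝ) - k) / ((r : ℝ) - 1)) /
        (if r < d then 1 else Real.log n) ^ (1 / ((r : ℝ) - 1))) ≤ fLin n d k r := by
  classical
  obtain ⟨C, hC1, hC⟩ := exists_card_degenerate_le d k r (by omega) hrd
  have hr1 : (0 : ℝ) < (r : ℝ) - 1 := by
    have : (2 : ℝ) ≤ r := by exact_mod_cast (by omega : 2 ≤ r)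
    linarith
  refine ⟨(2 * C) ^ (-(1 / ((r : ℝ) - 1))) / 2, by positivity, fun n hn => ?_⟩
  have hn' : (3 : ℝ) ≤ n := by exact_mod_cast hn
  have hn0 : (0 : ℝ) < n := by linarith
  have hlog1 : 1 ≤ Real.log n := by
    rw [Real.le_log_iff_exp_le hn0]
    linarith [Real.exp_one_lt_d9]
  have hB := hC n hn
  set L : ℝ := if r < d then 1 else Real.log n with hL
  have hL1 : 1 ≤ L := by rw [hL]; split_ifs <;> linarith
  set 𝓑 := ((latticeCube n d).powersetCard r).filter fun R : Finset (Fin d → ℕ) => Module.finrank ℝ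
    (Submodule.span ℝ (toRealPoint '' (R : Set (Fin d → ℕ)))) ≤ k with h𝓑
  -- The density is chosen so that the expected number of bad sets is at most half the expected
  -- size of the random set.
  set Y : ℝ := 2 * C * (n : ℝ) ^ ((k - 1) * d) * L with hY
  have hY1 : 1 ≤ Y := by
    have h1 : (1 : ℝ) ≤ (n : ℝ) ^ ((k - 1) * d) := one_le_pow₀ (by linarith)
    have h2 : 1 ≤ 2 * C * (n : ℝ) ^ ((k - 1) * d) :=
      one_le_mul_of_one_le_of_one_le (by linarith) h1
    exact one_le_mul_of_one_le_of_one_le h2 hL1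
  have hY0 : 0 < Y := by linarith
  set p : ℝ := Y ^ (-(1 / ((r : ℝ) - 1))) with hp
  have hp0 : 0 < p := Real.rpow_pos_of_pos hY0 _
  have hp1 : p ≤ 1 := Real.rpow_le_one_of_one_le_of_nonpos hY1 (by
    rw [Left.neg_nonpos_iff]; positivity)
  have hpr : p ^ (r - 1) = Y⁻¹ := by
    rw [hp, ← Real.rpow_natCast, ← Real.rpow_mul hY0.le, Nat.cast_sub (by omega), Nat.cast_one,
      neg_mul, one_div, inv_mul_cancel₀ hr1.ne', Real.rpow_neg_one]
  obtain ⟨S, hSX, hSB, hScard⟩ := exists_independent_subset (latticeCube n d) 𝓑 r (by omega)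
    (fun R hR => Finset.mem_powersetCard.1 (Finset.mem_filter.1 hR).1) hp0.le hp1
  have havoid : AvoidsLinear k r S := by
    intro W hW
    by_contra! hle
    obtain ⟨R, hRS, hRcard⟩ := Finset.exists_subset_card_eq hle
    have hRS' : R ⊆ S := fun x hx => (Finset.mem_filter.1 (hRS hx)).1
    refine hSB R (Finset.mem_filter.2 ⟨Finset.mem_powersetCard.2 ⟨hRS'.trans hSX, hRcard⟩, ?_⟩) hRS'
    rw [← hW]
    refine Submodule.finrank_mono ?_
    rw [Submodule.span_le]
    rintro _ ⟨x, hx, rfl⟩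
    exact (Finset.mem_filter.1 (hRS hx)).2
  have hX : ((latticeCube n d).card : ℝ) = (n : ℝ) ^ d := by
    rw [latticeCube, Fintype.card_piFinset_const]
    simp
  have hBp : (𝓑.card : ℝ) * p ^ r ≤ p * (n : ℝ) ^ d / 2 := by
    have h1 : p ^ r = p * Y⁻¹ := by
      rw [← hpr, ← pow_succ']
      congr 1
      omega
    have h2 : C * ((n : ℝ) ^ (k * d) * L) = Y * (n : ℝ) ^ d / 2 := by
      have : k * d = (k - 1) * d + d := by
        nth_rewrite 1 [show k = k - 1 + 1 by omega]
        ring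
      rw [hY, this, pow_add]
      ring
    rw [h2] at hB
    calc _ ≤ Y * (n : ℝ) ^ d / 2 * (p * Y⁻¹) := by
          rw [h1]
          gcongr
      _ = _ := by field_simp
  have hfinal : p * (n : ℝ) ^ d / 2 ≤ fLin n d k r := by
    have h1 : (S.card : ℝ) ≤ fLin n d k r := by exact_mod_cast card_le_fLin hSX havoid
    rw [hX] at hScard
    linarith
  refine le_trans (le_of_eq ?_) hfinal
  rw [hp, hY, Real.mul_rpow (x := 2 * C * (n : ℝ) ^ ((k - 1) * d)) (by positivity) (by linarith),
    Real.mul_rpow (x := 2 * C) (by positivity) (by positivity), ← Real.rpow_natCast,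
    ← Real.rpow_natCast, ← Real.rpow_mul hn0.le, Real.rpow_neg (by linarith : 0 ≤ L)]
  have hexp : (d : ℝ) * ((r : ℝ) - k) / ((r : ℝ) - 1) =
      (((k - 1) * d : ℕ) : ℝ) * -(1 / ((r : ℝ) - 1)) + d := by
    rw [Nat.cast_mul, Nat.cast_sub hk]
    field_simp
    push_cast
    ring
  rw [hexp, Real.rpow_add hn0]
  ring

theorem theorem1p2 (d k : ℕ) (hk : 1 ≤ k) (hkd : k < d) :
    (∀ r : ℕ, k + 1 ≤ r → IsOmega (fun n => (fLin n d k r : ℝ)) (gLin d k r)) ∧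
    IsOmega (fun n => (fLin n d k (k + 1) : ℝ)) (hLin d k) := by
  have hmain : ∀ r : ℕ, k + 1 ≤ r → IsOmega (fun n => (fLin n d k r : ℝ)) (gLin d k r) := by
    intro r hkr
    by_cases hrd : r < d
    · obtain ⟨c, hc, h⟩ := exists_le_fLin d k r hk hkr hrd.le
      refine ⟨c, hc, eventually_atTop.2 ⟨3, fun n hn => ?_⟩⟩
      have := h n hn
      rw [if_pos hrd, Real.one_rpow, div_one] at this
      rwa [gLin, if_pos hrd]
    · obtain ⟨c, hc, h⟩ := exists_le_fLin d k d hk hkd le_rfl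
      refine ⟨c, hc, eventually_atTop.2 ⟨3, fun n hn => ?_⟩⟩
      have := h n hn
      rw [if_neg (lt_irrefl d)] at this
      rw [gLin, if_neg hrd]
      exact this.trans (Nat.cast_le.2 (fLin_mono (not_lt.1 hrd)))
  refine ⟨hmain, ?_⟩
  have hgh : hLin d k = gLin d k (k + 1) := by
    funext n
    rw [hLin, gLin]
    by_cases hd : k + 1 = d
    · rw [if_pos hd, if_neg (by omega)]
    · rw [if_neg hd, if_pos (by omega)]
      congr 1
      push_cast
      rw [add_sub_cancel_left, add_sub_cancel_right, mul_one]
  rw [hgh]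
  exact hmain (k + 1) le_rfl
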